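/- Let $p$ be a prime, let $K$ be a finite extension of $\mathbf{Q}_p$ with ring of integers $\mathcal{O}$ and maximal ideal $\mathfrak{m}$, and let $m\ge 0$ be an integer. For a prime $q$ let $G_q$ be the Galois group of the maximal tamely ramified extension of $\mathbf{Q}_q$ (inside a fixed algebraic closure), with its Krull topology. The inertia subgroup of $G_q$ consists of the elements that act trivially on the residue field; a homomorphism from $G_q$ to a group is called ramified if it is non-trivial on the inertia subgroup. Let $\tau_q$ denote a topological generator of the inertia subgroup of $G_q$. (1) There is a constant $B$, depending only on $K$ and $m$, such that for every prime $q$, every such $\tau_q$ and every continuous representation $\theta : G_q \to GL_m(K)$, every root (in an algebraic closure of $K$) of the characteristic polynomial of $\theta(\tau_q)$ is a root of unity of order at most $B$. (2) There is an integer $N = N(m,K)\ge 0$, depending only on $m$ and $K$, such that for every prime $q$, every such $\tau_q$ and every continuous representation $\theta : G_q \to GL_m(K)$ for which the characteristic polynomial of $\theta(\tau_q)$ is not $(x-1)^m$, the following holds: for every representation $\rho : G_q \to GL_m(\mathcal{O})$ that is conjugate to $\theta$ by an element of $GL_m(K)$, the reduction $G_q \to GL_m(\mathcal{O}/\mathfrak{m}^N)$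 of $\rho$ is ramified. -/

import Mathlib

noncomputable section

namespace TameGalois

/-- The valuation ring `𝒪 = {x ∈ K : ‖x‖ ≤ 1}` of a finite extension `K` of `ℚ_p`, whose (multiplicative)
norm extends the `p`-adic one. -/
def ringOfIntegers (p : ℕ) [Fact p.Prime] (K : Type*) [NormedField K] [NormedAlgebra ℚ_[p] K] :
    ValuationSubring K :=
  letI : IsUltrametricDist K := IsUltrametricDist.of_normedAlgebra ℚ_[p]
  (NormedField.valuation (K := K)).valuationSubring

theorem mem_ringOfIntegers_iff (p : ℕ) [Fact p.Prime] (K : Type*) [NormedField K]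
    [NormedAlgebra ℚ_[p] K] (x : K) : x ∈ ringOfIntegers p K ↔ ‖x‖ ≤ 1 :=
  Iff.rfl

section LocalField

variable (q : ℕ) [Fact q.Prime]

/-- A finite extension `L` of `ℚ_q` inside the algebraic closure of `ℚ_q` is tamely ramified if its
ramification index is prime to `q` (its residue field extension is always separable). -/
def IsTame (L : IntermediateField ℚ_[q] (PadicAlgCl q)) : Prop :=
  ∀ P : Ideal (integralClosure ℤ_[q] L), P.IsMaximal → (P.ramificationIdx ℤ_[q]).Coprime q

/-- The maximal tamely ramified extension of `ℚ_q`: the compositum of all finite tamely ramified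
extensions of `ℚ_q` inside its algebraic closure. -/
def maxTame : IntermediateField ℚ_[q] (PadicAlgCl q) :=
  ⨆ L : {L : IntermediateField ℚ_[q] (PadicAlgCl q) // FiniteDimensional ℚ_[q] L ∧ IsTame q L},
    (L : IntermediateField ℚ_[q] (PadicAlgCl q))

/-- The tame Galois group `G_q`: the Galois group of the maximal tamely ramified extension of `ℚ_q`,
with its Krull topology. -/
abbrev tameGaloisGroup : Type := maxTame q ≃ₐ[ℚ_[q]] maxTame q

variable {q}

/-- The Galois group preserves the absolute value. -/
theorem norm_apply_eq (s : tameGaloisGroup q) (x : maxTame q) :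
    ‖((s x : maxTame q) : PadicAlgCl q)‖ = ‖(x : PadicAlgCl q)‖ := by
  rw [← PadicAlgCl.spectralNorm_eq, ← PadicAlgCl.spectralNorm_eq]
  unfold spectralNorm
  have h (y : maxTame q) : minpoly ℚ_[q] (y : PadicAlgCl q) = minpoly ℚ_[q] y :=
    minpoly.algebraMap_eq (B := maxTame q) (B' := PadicAlgCl q)
      (algebraMap (maxTame q) (PadicAlgCl q)).injective y
  rw [h, h, minpoly.algEquiv_eq]

variable (q) in
/-- The tame inertia group: the elements of `G_q` that act trivially on the residue field, i.e. such
that `s x ≡ x` modulo the maximal ideal, for all integral `x`. -/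
def tameInertia : Subgroup (tameGaloisGroup q) where
  carrier := {s | ∀ x : maxTame q, ‖(x : PadicAlgCl q)‖ ≤ 1 →
    ‖((s x - x : maxTame q) : PadicAlgCl q)‖ < 1}
  one_mem' := fun x _ ↦ by simp
  mul_mem' := by
    intro s t hs ht x hx
    have h1 := hs (t x) (by rwa [norm_apply_eq])
    have h2 := ht x hx
    have h3 : (((s * t) x - x : maxTame q) : PadicAlgCl q) =
        ((s (t x) - t x : maxTame q) : PadicAlgCl q) + ((t x - x : maxTame q) : PadicAlgCl q) := by
      simp [AlgEquiv.mul_apply]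
    rw [h3]
    exact (IsUltrametricDist.norm_add_le_max _ _).trans_lt (max_lt h1 h2)
  inv_mem' := by
    intro s hs x hx
    have hx' : ‖((s⁻¹ x : maxTame q) : PadicAlgCl q)‖ ≤ 1 := by rwa [norm_apply_eq]
    have h1 := hs (s⁻¹ x) hx'
    have h2 : s (s⁻¹ x) = x := by
      rw [← AlgEquiv.mul_apply, mul_inv_cancel, AlgEquiv.one_apply]
    rw [h2, ← neg_sub, NegMemClass.coe_neg, norm_neg] at h1
    exact h1

/-- `τ` is a topological generator of the tame inertia group. -/
def IsTameInertiaGenerator (τ : tameGaloisGroup q) : Prop :=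
  (Subgroup.zpowers τ).topologicalClosure = tameInertia q

/-- A homomorphism from `G_q` to any group is ramified if it is nontrivial on the inertia group. -/
def IsRamified {H : Type*} [Group H] (ρ : tameGaloisGroup q →* H) : Prop :=
  ∃ s ∈ tameInertia q, ρ s ≠ 1

end LocalField

section Reduction

variable {p : ℕ} [Fact p.Prime] {K : Type*} [NormedField K] [NormedAlgebra ℚ_[p] K] {m : ℕ}

/-- A homomorphism `ρ : G → GL_m(𝒪)` is a conjugate of `θ : G → GL_m(K)` if for some `g ∈ GL_m(K)` it
becomes `s ↦ g θ(s) g⁻¹` over `K`. -/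
def IsIntegralConjugate {G : Type*} [Group G] (θ : G →* GL (Fin m) K)
    (ρ : G →* GL (Fin m) (ringOfIntegers p K)) : Prop :=
  ∃ g : GL (Fin m) K, ∀ s : G,
    Matrix.GeneralLinearGroup.map (algebraMap (ringOfIntegers p K) K) (ρ s) = g * θ s * g⁻¹

/-- The reduction of `ρ : G → GL_m(𝒪)` modulo the power `𝔪 ^ n` of the maximal ideal `𝔪` of `𝒪`. -/
def reduction {G : Type*} [Group G] (ρ : G →* GL (Fin m) (ringOfIntegers p K)) (n : ℕ) :
    G →* GL (Fin m)
      (ringOfIntegers p K ⧸ IsLocalRing.maximalIdeal (ringOfIntegers p K) ^ n) :=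
  (Matrix.GeneralLinearGroup.map
    (Ideal.Quotient.mk (IsLocalRing.maximalIdeal (ringOfIntegers p K) ^ n))).comp ρ

end Reduction

end TameGalois

end

/-! Frobenius acts on tame inertia by `σ ↦ σ ^ q` (`exists_conj_eq_pow`), so `θ τ` is conjugate to
its `q`-th power. Its finite set of eigenvalues is stable under `z ↦ z ^ q`, hence consists of roots
of unity (`isOfFinOrder_of_aeval_charpoly_eq_zero`).

Both bounds then rest on one fact: a root of unity congruent to `1` modulo `p ^ 2` is `1`, because
`p ^ 2` divides no prime among algebraic integers (`eq_one_of_pow_eq_one_of_eq_one_add_mul`). For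
(1), an eigenvalue `ζ` has degree at most `d = [K : ℚ_p] * m` over `ℚ_p`; by pigeonhole two of its
first powers agree modulo `p ^ 2`, which bounds its order by `p ^ (2 * d)`. For (2), take `𝔪 ^ N ⊆ p
^ 2 𝒪`. If the reduction kills `τ`, then `ρ τ = 1 + p ^ 2 M` with `M` integral, so every eigenvalue
is congruent to `1` modulo `p ^ 2`, hence equals `1`.

The tame relation is checked on radicals `y ^ n = q ^ k` with `n` prime to `q`. These determine an
automorphism (`tameGaloisGroup_ext`): each nonzero element of a finite tame extension is such a
radical up to a smaller error, and the approximation can be iterated. -/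

/-! ### Roots of unity and congruences modulo `p ^ 2` -/

section RootsOfUnity

/-- A nontrivial root of unity in a field is not congruent to `1` modulo `a`, with respect to a
subring in which `a` divides no prime number. -/
theorem eq_one_of_pow_eq_one_of_eq_one_add_mul {F : Type*} [Field F] (S : Subring F) {a : F}
    (ha : a ∈ S) (h : ∀ l : ℕ, l.Prime → ∀ s ∈ S, (l : F) ≠ a * s) {z y : F} {n : ℕ} (hn : 0 < n)
    (hz : z ^ n = 1) (hy : y ∈ S) (hzy : z = 1 + a * y) : z = 1 := by
  have hpow (w : F) (hw : ∃ x ∈ S, w = 1 + a * x) (k : ℕ) : ∃ x ∈ S, w ^ k = 1 + a * x := by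
    obtain ⟨x, hx, rfl⟩ := hw
    induction k with
    | zero => exact ⟨0, S.zero_mem, by simp⟩
    | succ k ih =>
      obtain ⟨u, hu, hk⟩ := ih
      exact ⟨u + x + a * u * x, S.add_mem (S.add_mem hu hx) (S.mul_mem (S.mul_mem ha hu) hx),
        by rw [pow_succ, hk]; ring⟩
  by_contra hne
  have hfin : IsOfFinOrder z := isOfFinOrder_iff_pow_eq_one.2 ⟨n, hn, hz⟩
  obtain ⟨l, hl, k, hk⟩ := Nat.exists_prime_and_dvd (fun h1 ↦ hne (orderOf_eq_one_iff.1 h1))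
  have hk0 : k ≠ 0 := by
    rintro rfl
    exact hfin.orderOf_pos.ne' (by simpa using hk)
  have hw1 : z ^ k ≠ 1 := fun h1 ↦ by
    have := Nat.le_of_dvd (Nat.pos_of_ne_zero hk0) (orderOf_dvd_of_pow_eq_one h1)
    rw [hk] at this
    nlinarith [hl.two_le, Nat.pos_of_ne_zero hk0]
  have hwl : (z ^ k) ^ l = 1 := by rw [← pow_mul, mul_comm, ← hk, pow_orderOf_eq_one]
  have hw := hpow z ⟨y, hy, hzy⟩ k
  choose x hxS hx using hpow (z ^ k) hw
  -- `z ^ k` has prime order `l`, so its `l` powers sum to `0`; each is `1` modulo `a`, which forces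
  -- `a` to divide `l`.
  have hsum : ∑ i ∈ Finset.range l, (z ^ k) ^ i = 0 := by
    have := geom_sum_mul (z ^ k) l
    rw [hwl, sub_self] at this
    exact (mul_eq_zero.1 this).resolve_right (sub_ne_zero.2 hw1)
  refine h l hl (-∑ i ∈ Finset.range l, x i) (S.neg_mem (S.sum_mem fun i _ ↦ hxS i)) ?_
  simp_rw [hx] at hsum
  rw [Finset.sum_add_distrib, ← Finset.mul_sum] at hsum
  simp only [Finset.sum_const, Finset.card_range, nsmul_eq_mul, mul_one] at hsum
  linear_combination hsum

/-- Among the powers of a root of a monic polynomial of degree `d` over `ℤ_p`, two with exponents at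
most `p ^ (2 * d)` are congruent modulo `p ^ 2`. -/
theorem exists_pow_sub_pow_eq_sq_mul {p : ℕ} [Fact p.Prime] {F : Type*} [Field F] [Algebra ℤ_[p] F]
    {f : Polynomial ℤ_[p]} (hf : f.Monic) {z : F} (hz : Polynomial.aeval z f = 0) :
    ∃ i j : ℕ, i < j ∧ j ≤ p ^ (2 * f.natDegree) ∧ ∃ g : Polynomial ℤ_[p],
      z ^ j - z ^ i = (p : F) ^ 2 * Polynomial.aeval z g := by
  open Polynomial in
  have : NeZero (p ^ 2) := ⟨pow_ne_zero _ (Fact.out : p.Prime).ne_zero⟩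
  -- Pigeonhole: the remainder of `X ^ i` by `f`, read modulo `p ^ 2`, takes at most `(p ^ 2) ^ deg
  -- f` values.
  let c : ℕ → Fin f.natDegree → ZMod (p ^ 2) := fun i k ↦
    PadicInt.toZModPow 2 ((X ^ i %ₘ f).coeff k)
  have hcard : Fintype.card (Fin f.natDegree → ZMod (p ^ 2)) <
      Fintype.card (Fin (p ^ (2 * f.natDegree) + 1)) := by
    simp [ZMod.card, ← pow_mul]
  obtain ⟨i, j, hne, hij⟩ := Fintype.exists_ne_map_eq_of_card_lt
    (fun i : Fin (p ^ (2 * f.natDegree) + 1) ↦ c i) hcard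
  wlog hlt : i < j generalizing i j
  · exact this j i hne.symm hij.symm (lt_of_le_of_ne (not_lt.1 hlt) hne.symm)
  refine ⟨i, j, hlt, Nat.lt_succ_iff.1 j.2, ?_⟩
  have hdvd : C ((p : ℤ_[p]) ^ 2) ∣ X ^ (j : ℕ) %ₘ f - X ^ (i : ℕ) %ₘ f := by
    rw [C_dvd_iff_dvd_coeff]
    intro k
    by_cases hk : k < f.natDegree
    · have := congrFun hij ⟨k, hk⟩
      simp only [c] at this
      rw [coeff_sub, ← Ideal.mem_span_singleton, ← PadicInt.ker_toZModPow, RingHom.mem_ker, map_sub,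
        this, sub_self]
    · have hlt' (r : ℕ) : (X ^ r %ₘ f).coeff k = 0 :=
        coeff_eq_zero_of_degree_lt ((degree_modByMonic_lt _ hf).trans_le
          (degree_le_natDegree.trans (by exact_mod_cast not_lt.1 hk)))
      simp [hlt']
  obtain ⟨g, hg⟩ := hdvd
  refine ⟨g, ?_⟩
  have hmod (r : ℕ) : aeval z (X ^ r %ₘ f) = z ^ r := by
    rw [aeval_modByMonic_eq_self_of_root hz]; simp
  have := congrArg (aeval z) hg
  simpa [hmod] using this

end RootsOfUnity

/-! ### Units and roots in the algebraic closure of `ℚ_q` -/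

section PadicAlgCl

/-- If `z ≠ 1`, the powers of `z` sum to `0`, yet each lies within `‖z - 1‖ < 1` of `1`, so `‖n‖ <
1`. -/
theorem eq_one_of_pow_eq_one_of_norm_sub_one_lt {F : Type*} [NormedField F] [IsUltrametricDist F]
    {n : ℕ} (hn : ‖(n : F)‖ = 1) {z : F} (hz : z ^ n = 1) (h : ‖z - 1‖ < 1) : z = 1 := by
  by_contra hne
  have hn0 : n ≠ 0 := by rintro rfl; simp at hn
  have hz1 : ‖z‖ = 1 := by
    have := congrArg norm hz
    rw [norm_pow, norm_one] at this
    exact (pow_eq_one_iff_of_nonneg (norm_nonneg _) hn0).1 this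
  have hsum : ∑ i ∈ Finset.range n, z ^ i = 0 := by
    have := geom_sum_mul z n
    rw [hz, sub_self] at this
    exact (mul_eq_zero.1 this).resolve_right (sub_ne_zero.2 hne)
  have hle (i : ℕ) : ‖z ^ i - 1‖ ≤ ‖z - 1‖ := by
    rw [← geom_sum_mul, norm_mul]
    refine mul_le_of_le_one_left (norm_nonneg _) ?_
    exact IsUltrametricDist.norm_sum_le_of_forall_le_of_nonneg zero_le_one
      fun i _ ↦ by simp [hz1]
  have : ‖∑ i ∈ Finset.range n, (z ^ i - 1)‖ ≤ ‖z - 1‖ :=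
    IsUltrametricDist.norm_sum_le_of_forall_le_of_nonneg (norm_nonneg _) fun i _ ↦ hle i
  rw [Finset.sum_sub_distrib, hsum] at this
  simp [hn] at this
  linarith

variable {q : ℕ} [Fact q.Prime]

theorem PadicAlgCl.norm_natCast_eq_one {n : ℕ} (hn : n.Coprime q) :
    ‖(n : PadicAlgCl q)‖ = 1 := by
  rw [← map_natCast (algebraMap ℚ_[q] (PadicAlgCl q)), PadicAlgCl.norm_extends]
  rw [Padic.norm_natCast_eq_one_iff]
  exact hn.symm

theorem PadicAlgCl.norm_prime : ‖(q : PadicAlgCl q)‖ = (q : ℝ)⁻¹ := by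
  rw [← map_natCast (algebraMap ℚ_[q] (PadicAlgCl q)), PadicAlgCl.norm_extends, Padic.norm_p]

/-- The norm is the spectral norm, read off the minimal polynomial over `ℚ_q`; that polynomial has
coefficients in `ℤ_q` for integral `x` since `ℤ_q` is integrally closed. -/
theorem PadicAlgCl.isIntegral_iff_norm_le_one (x : PadicAlgCl q) :
    IsIntegral ℤ_[q] x ↔ ‖x‖ ≤ 1 := by
  rw [← PadicAlgCl.spectralNorm_eq, spectralNorm]
  have hx : IsIntegral ℚ_[q] x := (Algebra.IsAlgebraic.isAlgebraic x).isIntegral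
  rw [spectralValue_le_one_iff (minpoly.monic hx)]
  constructor
  · intro h n
    rw [minpoly.isIntegrallyClosed_eq_field_fractions' ℚ_[q] h]
    simpa using PadicInt.norm_le_one _
  · intro h
    have hl : minpoly ℚ_[q] x ∈ Polynomial.lifts (algebraMap ℤ_[q] ℚ_[q]) := by
      rw [Polynomial.lifts_iff_coeff_lifts]
      exact fun n ↦ ⟨⟨_, h n⟩, rfl⟩
    obtain ⟨f, hf, -, hm⟩ := Polynomial.lifts_and_natDegree_eq_and_monic hl (minpoly.monic hx)
    refine ⟨f, hm, ?_⟩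
    have := minpoly.aeval ℚ_[q] x
    rw [← hf, Polynomial.aeval_map_algebraMap] at this
    exact this

theorem PadicAlgCl.norm_algEquiv (s : PadicAlgCl q ≃ₐ[ℚ_[q]] PadicAlgCl q) (x : PadicAlgCl q) :
    ‖s x‖ = ‖x‖ :=
  (spectralNorm_eq_of_equiv s x).symm

theorem norm_eq_one_of_norm_sub_one_lt {F : Type*} [NormedField F] [IsUltrametricDist F] {x : F}
    (h : ‖x - 1‖ < 1) : ‖x‖ = 1 := by
  have := IsUltrametricDist.norm_add_eq_max_of_norm_ne_norm (x := x - 1) (y := 1)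
    (by rw [norm_one]; exact h.ne)
  rw [sub_add_cancel, norm_one, max_eq_right h.le] at this
  exact this

/-- An element of `L` congruent to `1` has a root of each order prime to `q` in `L`. -/
theorem PadicAlgCl.exists_pow_eq_of_norm_sub_one_lt (L : IntermediateField ℚ_[q] (PadicAlgCl q))
    {a : PadicAlgCl q} (ha : a ∈ L) (h : ‖a - 1‖ < 1) {n : ℕ} (hn : n.Coprime q) :
    ∃ v ∈ L, v ^ n = a ∧ ‖v - 1‖ < 1 := by
  have hn1 : ‖(n : PadicAlgCl q)‖ = 1 := norm_natCast_eq_one hn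
  have hn0 : n ≠ 0 := by rintro rfl; simp at hn1
  -- `1 - a` is the product of `1 - v` over the roots `v`, so some factor has norm below `1`.
  obtain ⟨v, hv, hv1⟩ : ∃ v : PadicAlgCl q, v ^ n = a ∧ ‖v - 1‖ < 1 := by
    by_contra! hcon
    have hsplit := IsAlgClosed.splits (Polynomial.X ^ n - Polynomial.C a)
    have hmon : (Polynomial.X ^ n - Polynomial.C a).Monic := Polynomial.monic_X_pow_sub_C a hn0
    have heval := hsplit.eval_eq_prod_roots_of_monic hmon 1
    simp only [Polynomial.eval_sub, Polynomial.eval_pow, Polynomial.eval_X, one_pow,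
      Polynomial.eval_C] at heval
    have : 1 ≤ ‖1 - a‖ := by
      rw [heval]
      have hall : ∀ v ∈ (Polynomial.X ^ n - Polynomial.C a).roots, 1 ≤ ‖1 - v‖ := by
        intro v hv
        rw [Polynomial.mem_roots hmon.ne_zero] at hv
        rw [norm_sub_rev]
        refine hcon v ?_
        simpa [sub_eq_zero] using hv
      generalize (Polynomial.X ^ n - Polynomial.C a).roots = s at hall
      induction s using Multiset.induction_on with
      | empty => simp
      | cons v s ih =>
        simp only [Multiset.map_cons, Multiset.prod_cons, norm_mul]
        exact one_le_mul_of_one_le_of_one_le (hall v (by simp))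
          (ih fun w hw ↦ hall w (by simp [hw]))
    rw [norm_sub_rev] at this
    linarith
  refine ⟨v, ?_, hv, hv1⟩
  -- Galois descent: for `s` fixing `L`, `s v / v` is an `n`-th root of unity close to `1`, hence
  -- `1`.
  rw [← InfiniteGalois.fixedField_fixingSubgroup L, IntermediateField.mem_fixedField_iff]
  intro s hs
  have hv0 : ‖v‖ = 1 := norm_eq_one_of_norm_sub_one_lt hv1
  have hvne : v ≠ 0 := norm_ne_zero_iff.1 (by rw [hv0]; exact one_ne_zero)
  have hsa : s a = a := (IntermediateField.mem_fixingSubgroup_iff L s).1 hs a ha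
  have hdiv : s v / v = 1 := by
    refine eq_one_of_pow_eq_one_of_norm_sub_one_lt hn1 ?_ ?_
    · rw [div_pow, ← map_pow, hv, hsa, div_self]
      rw [← hv]; exact pow_ne_zero _ hvne
    · have : s v / v - 1 = (s (v - 1) - (v - 1)) / v := by
        rw [map_sub, map_one, sub_sub_sub_cancel_right, sub_div, div_self hvne]
      rw [this, norm_div, hv0, div_one]
      rw [sub_eq_add_neg]
      refine (IsUltrametricDist.norm_add_le_max _ _).trans_lt ?_
      rwa [norm_neg, norm_algEquiv, max_self]
  rwa [div_eq_one_iff_eq hvne] at hdiv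

/-- The residue of `u` is algebraic over a finite field, so it has finite order. The `q`-part of the
exponent can be dropped because `q`-th powers are injective in characteristic `q`. -/
theorem PadicAlgCl.exists_norm_pow_sub_one_lt {u : PadicAlgCl q} (hu : ‖u‖ = 1) :
    ∃ n : ℕ, n.Coprime q ∧ ‖u ^ n - 1‖ < 1 := by
  obtain ⟨f, hf, hfu⟩ := (isIntegral_iff_norm_le_one u).2 hu.le
  obtain ⟨i, j, hij, -, g, hg⟩ := exists_pow_sub_pow_eq_sq_mul hf (z := u) hfu
  have hq : q.Prime := Fact.out
  have hq1 : ‖(q : PadicAlgCl q)‖ < 1 := by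
    rw [norm_prime]; exact inv_lt_one_of_one_lt₀ (by exact_mod_cast hq.one_lt)
  have hg1 : ‖Polynomial.aeval u g‖ ≤ 1 := by
    rw [← isIntegral_iff_norm_le_one]
    exact adjoin_le_integralClosure ((isIntegral_iff_norm_le_one u).2 hu.le)
      (Polynomial.aeval_mem_adjoin_singleton _ _)
  have h1 : ‖u ^ (j - i) - 1‖ < 1 := by
    have : u ^ j - u ^ i = u ^ i * (u ^ (j - i) - 1) := by
      rw [mul_sub, ← pow_add, Nat.add_sub_cancel' hij.le, mul_one]
    have h2 := congrArg norm (this.symm.trans hg)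
    rw [norm_mul, norm_pow, hu, one_pow, one_mul, norm_mul, norm_pow] at h2
    rw [h2]
    exact mul_lt_one_of_nonneg_of_lt_one_left (by positivity)
      (pow_lt_one₀ (norm_nonneg _) hq1 two_ne_zero) hg1
  obtain ⟨a, n, hn, hjn⟩ := Nat.exists_eq_pow_mul_and_not_dvd (Nat.sub_ne_zero_of_lt hij) q hq.ne_one
  have hcop : n.Coprime q := ((Nat.Prime.coprime_iff_not_dvd hq).2 hn).symm
  rw [hjn, mul_comm, pow_mul] at h1
  refine ⟨n, hcop, ?_⟩
  have hun : ‖u ^ n‖ = 1 := by rw [norm_pow, hu, one_pow]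
  have hstep : ∀ (w : PadicAlgCl q), ‖w‖ = 1 → ‖w ^ q - 1‖ < 1 → ‖w - 1‖ < 1 := by
    intro w hw hwq
    have hx : ‖w - 1‖ ≤ 1 := by
      rw [sub_eq_add_neg]
      exact (IsUltrametricDist.norm_add_le_max _ _).trans (by simp [hw])
    obtain ⟨r, hr⟩ := exists_add_pow_prime_eq hq
      (⟨w - 1, (isIntegral_iff_norm_le_one _).2 hx⟩ : integralClosure ℤ_[q] (PadicAlgCl q)) 1
    have hr1 : ‖(r : PadicAlgCl q)‖ ≤ 1 := (isIntegral_iff_norm_le_one _).1 r.2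
    have hr2 := congrArg (Subtype.val) hr
    simp only [Subalgebra.coe_pow, Subalgebra.coe_add, Subalgebra.coe_one, sub_add_cancel, one_pow,
      Subalgebra.coe_mul, mul_one] at hr2
    change w ^ q = (w - 1) ^ q + 1 + (q : PadicAlgCl q) * (w - 1) * r at hr2
    have hxq : (w - 1) ^ q = (w ^ q - 1) + -(q * (w - 1) * r) := by rw [hr2]; ring
    have hlt : ‖(w - 1) ^ q‖ < 1 := by
      rw [hxq]
      refine (IsUltrametricDist.norm_add_le_max _ _).trans_lt (max_lt hwq ?_)
      rw [norm_neg, norm_mul, norm_mul]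
      exact mul_lt_one_of_nonneg_of_lt_one_left (by positivity)
        (mul_lt_one_of_nonneg_of_lt_one_left (norm_nonneg _) hq1 hx) hr1
    rw [norm_pow] at hlt
    exact (pow_lt_one_iff_of_nonneg (norm_nonneg _) hq.ne_zero).1 hlt
  clear hjn
  induction a with
  | zero => simpa using h1
  | succ a ih =>
    refine ih (hstep _ (by rw [norm_pow, hun, one_pow]) ?_)
    rwa [← pow_mul, ← pow_succ]

end PadicAlgCl

/-! ### Frobenius elements in infinite Galois extensions -/

section Frobenius

/-- Frobenius elements exist in the automorphism groups of (possibly infinite) Galois extensions. -/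
theorem exists_forall_sub_pow_mem {A K L : Type*} [CommRing A] [Field K] [Field L]
    [Algebra A K] [IsFractionRing A K] [Algebra K L] [Algebra A L] [IsScalarTower A K L]
    [IsIntegrallyClosed A] [IsGalois K L] (P : Ideal A) [P.IsMaximal] [Finite (A ⧸ P)]
    (Q : Ideal (integralClosure A L)) [Q.IsPrime] [Q.LiesOver P] :
    ∃ σ : L ≃ₐ[K] L, ∀ x y : integralClosure A L, (y : L) = σ x → y - x ^ Nat.card (A ⧸ P) ∈ Q := by
  have : SMulCommClass Gal(L/K) A L := ⟨fun σ a x ↦ by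
    simp only [AlgEquiv.smul_def, Algebra.smul_def, map_mul, IsScalarTower.algebraMap_apply A K L,
      AlgEquiv.commutes]⟩
  -- The action on the discrete ring is continuous, as the stabilizer of `x` contains the open
  -- subgroup fixing `K(x)`. This and the invariance below allow residue automorphisms to be lifted.
  let _ : TopologicalSpace (integralClosure A L) := ⊥
  have : DiscreteTopology (integralClosure A L) := ⟨rfl⟩
  have : ContinuousSMul Gal(L/K) (integralClosure A L) := by
    rw [continuousSMul_iff_stabilizer_isOpen]
    intro x
    have hx : IsIntegral K (x : L) := (Algebra.IsAlgebraic.isAlgebraic (x : L)).isIntegral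
    have := IntermediateField.adjoin.finiteDimensional hx
    refine Subgroup.isOpen_mono (H₁ := (IntermediateField.adjoin K {(x : L)}).fixingSubgroup) ?_
      (IntermediateField.fixingSubgroup_isOpen _)
    intro σ hσ
    rw [MulAction.mem_stabilizer_iff]
    ext
    exact (IntermediateField.mem_fixingSubgroup_iff _ σ).1 hσ x
      (IntermediateField.mem_adjoin_simple_self K _)
  have : Algebra.IsInvariant A (integralClosure A L) Gal(L/K) := by
    refine ⟨fun b hb ↦ ?_⟩
    have hb' : (b : L) ∈ (⊥ : IntermediateField K L) := by
      rw [InfiniteGalois.mem_bot_iff_fixed]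
      exact fun σ ↦ congrArg Subtype.val (hb σ)
    obtain ⟨k, hk⟩ := IntermediateField.mem_bot.1 hb'
    have hkint : IsIntegral A k := by
      rw [← isIntegral_algebraMap_iff (algebraMap K L).injective, hk]
      exact b.2
    obtain ⟨a, rfl⟩ := IsIntegrallyClosed.algebraMap_eq_of_integral hkint
    refine ⟨a, Subtype.ext ?_⟩
    rw [← hk, ← IsScalarTower.algebraMap_apply]
    rfl
  let _ : Field (A ⧸ P) := Ideal.Quotient.field P
  have : Q.IsMaximal := Ideal.isMaximal_of_isIntegral_of_isMaximal_comap (R := A) Q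
    (by rw [← Ideal.under_def, ← Ideal.over_def Q P]; infer_instance)
  let _ : Field (integralClosure A L ⧸ Q) := Ideal.Quotient.field Q
  let _ : Fintype (A ⧸ P) := Fintype.ofFinite _
  have : Algebra.IsAlgebraic (A ⧸ P) (integralClosure A L ⧸ Q) :=
    have : Algebra.IsIntegral (A ⧸ P) (integralClosure A L ⧸ Q) :=
      Ideal.Quotient.algebra_isIntegral_of_liesOver Q P
    Algebra.IsIntegral.isAlgebraic
  obtain ⟨σ, hσ⟩ := Ideal.Quotient.stabilizerHom_surjective_of_profinite (G := Gal(L/K)) P Q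
    (FiniteField.frobeniusAlgEquivOfAlgebraic (A ⧸ P) (integralClosure A L ⧸ Q))
  refine ⟨σ, fun x y hy ↦ ?_⟩
  rw [← Ideal.Quotient.eq_zero_iff_mem, map_sub, map_pow, sub_eq_zero]
  have h := DFunLike.congr_fun hσ (Ideal.Quotient.mk Q x)
  rw [FiniteField.coe_frobeniusAlgEquivOfAlgebraic] at h
  have hyx : y = (σ : Gal(L/K)) • x := Subtype.ext hy
  rw [hyx, Nat.card_eq_fintype_card]
  exact h

end Frobenius

/-! ### Tame extensions and their approximation by radicals of `q` -/

section Tame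

open TameGalois

variable {q : ℕ} [Fact q.Prime]

theorem PadicAlgCl.isIntegral_coe_iff_norm_le_one {L : IntermediateField ℚ_[q] (PadicAlgCl q)}
    (x : L) : IsIntegral ℤ_[q] x ↔ ‖(x : PadicAlgCl q)‖ ≤ 1 := by
  have : IsScalarTower ℤ_[q] L (PadicAlgCl q) := IsScalarTower.of_algebraMap_eq fun _ ↦ rfl
  rw [← isIntegral_iff_norm_le_one]
  exact (isIntegral_algebraMap_iff (algebraMap L (PadicAlgCl q)).injective).symm

theorem PadicAlgCl.isUnit_iff_norm_eq_one {L : IntermediateField ℚ_[q] (PadicAlgCl q)}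
    (x : integralClosure ℤ_[q] L) : IsUnit x ↔ ‖((x : L) : PadicAlgCl q)‖ = 1 := by
  have hle (y : integralClosure ℤ_[q] L) := (isIntegral_coe_iff_norm_le_one (y : L)).1 y.2
  constructor
  · intro h
    obtain ⟨y, hy⟩ := h.exists_right_inv
    have h1 : ((x : L) : PadicAlgCl q) * ((y : L) : PadicAlgCl q) = 1 := by
      exact_mod_cast congrArg (fun z : integralClosure ℤ_[q] L ↦ ((z : L) : PadicAlgCl q)) hy
    have h2 := congrArg norm h1
    rw [norm_mul, norm_one] at h2
    refine le_antisymm (hle x) ?_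
    rw [← h2]
    exact mul_le_of_le_one_right (norm_nonneg _) (hle y)
  · intro h
    have hx : (x : L) ≠ 0 := by
      intro h0
      rw [h0] at h
      simp at h
    refine IsUnit.of_mul_eq_one ⟨(x : L)⁻¹, ?_⟩ (Subtype.ext (mul_inv_cancel₀ hx))
    rw [mem_integralClosure_iff, isIntegral_coe_iff_norm_le_one]
    simp [h]

instance PadicAlgCl.isLocalRing_integralClosure (L : IntermediateField ℚ_[q] (PadicAlgCl q)) :
    IsLocalRing (integralClosure ℤ_[q] L) := by
  refine IsLocalRing.of_nonunits_add fun a b ha hb ↦ ?_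
  have hlt (y : integralClosure ℤ_[q] L) : y ∈ nonunits _ ↔ ‖((y : L) : PadicAlgCl q)‖ < 1 := by
    rw [mem_nonunits_iff, isUnit_iff_norm_eq_one]
    exact ⟨fun h ↦ lt_of_le_of_ne ((isIntegral_coe_iff_norm_le_one (y : L)).1 y.2) h, fun h ↦ h.ne⟩
  rw [hlt] at *
  exact (IsUltrametricDist.norm_add_le_max _ _).trans_lt (max_lt ha hb)

theorem PadicAlgCl.mem_maximalIdeal_iff {L : IntermediateField ℚ_[q] (PadicAlgCl q)}
    (x : integralClosure ℤ_[q] L) :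
    x ∈ IsLocalRing.maximalIdeal (integralClosure ℤ_[q] L) ↔ ‖((x : L) : PadicAlgCl q)‖ < 1 := by
  rw [IsLocalRing.mem_maximalIdeal, mem_nonunits_iff, isUnit_iff_norm_eq_one]
  exact ⟨fun h ↦ lt_of_le_of_ne ((isIntegral_coe_iff_norm_le_one (x : L)).1 x.2) h, fun h ↦ h.ne⟩

theorem PadicAlgCl.norm_prime_lt_one : ‖(q : PadicAlgCl q)‖ < 1 := by
  rw [norm_prime]
  exact inv_lt_one_of_one_lt₀ (by exact_mod_cast (Fact.out : q.Prime).one_lt)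

theorem PadicAlgCl.norm_prime_pos : 0 < ‖(q : PadicAlgCl q)‖ := by
  rw [norm_prime]
  exact inv_pos.2 (by exact_mod_cast (Fact.out : q.Prime).pos)

theorem PadicAlgCl.isDedekindDomain_integralClosure (L : IntermediateField ℚ_[q] (PadicAlgCl q))
    [FiniteDimensional ℚ_[q] L] : IsDedekindDomain (integralClosure ℤ_[q] L) :=
  integralClosure.isDedekindDomain ℤ_[q] ℚ_[q] L

theorem under_isMaximal_eq_maximalIdeal {A B : Type*} [CommRing A] [CommRing B] [Algebra A B]
    [IsLocalRing A] [Algebra.IsIntegral A B] (P : Ideal B) [P.IsMaximal] :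
    P.under A = IsLocalRing.maximalIdeal A :=
  IsLocalRing.eq_maximalIdeal (Ideal.isMaximal_comap_of_isIntegral_of_isMaximal (R := A) P)

/-- Identifies the ramification index with the order of vanishing of `b`, so that tameness becomes a
statement about norms. -/
theorem ramificationIdx_eq_of_map_under_eq_span {A B : Type*} [CommRing A] [CommRing B]
    [Algebra A B] [IsDomain B] [IsDiscreteValuationRing B] (P : Ideal B) [P.IsMaximal] {ϖ b : B}
    (hϖ : Irreducible ϖ) {e : ℕ} {u : Bˣ} (hb : b = u * ϖ ^ e)
    (hmap : (P.under A).map (algebraMap A B) = Ideal.span {b}) :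
    P.ramificationIdx A = e := by
  have hPϖ : P = Ideal.span {ϖ} :=
    (IsLocalRing.eq_maximalIdeal ‹_›).trans
      ((IsDiscreteValuationRing.irreducible_iff_uniformizer ϖ).1 hϖ)
  have hb0 : b ≠ 0 := hb ▸ mul_ne_zero u.ne_zero (pow_ne_zero e hϖ.ne_zero)
  rw [← Ideal.ramificationIdx'_eq_ramificationIdx' (P.under A) P (by
    rwa [hmap, Ne, Ideal.span_singleton_eq_bot])]
  apply Ideal.ramificationIdx'_spec
  · rw [hmap, hPϖ, Ideal.span_singleton_pow, Ideal.span_singleton_le_span_singleton, hb]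
    exact Dvd.intro_left _ rfl
  · rw [hmap, hPϖ, Ideal.span_singleton_pow, Ideal.span_singleton_le_span_singleton, hb]
    rintro ⟨c, hc⟩
    rw [pow_succ, mul_comm, mul_assoc] at hc
    have := mul_left_cancel₀ (pow_ne_zero e hϖ.ne_zero) hc
    exact hϖ.not_isUnit (isUnit_of_mul_isUnit_left (this ▸ u.isUnit))

/-- The valuation of a tame extension takes values in `(1 / e) ℤ` with `e` prime to `q`. -/
theorem TameGalois.IsTame.exists_norm_pow_eq {L : IntermediateField ℚ_[q] (PadicAlgCl q)}
    [FiniteDimensional ℚ_[q] L] (hL : IsTame q L) :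
    ∃ e : ℕ, e.Coprime q ∧ ∀ x ∈ L, x ≠ 0 → ∃ k : ℤ, ‖x‖ ^ e = ‖(q : PadicAlgCl q)‖ ^ k := by
  have := PadicAlgCl.isDedekindDomain_integralClosure L
  set R := integralClosure ℤ_[q] L with hR
  set P := IsLocalRing.maximalIdeal R with hP
  have hcast : (((q : R) : L) : PadicAlgCl q) = q := rfl
  have hq0 : (q : R) ≠ 0 := fun h ↦ by
    have h1 := PadicAlgCl.norm_prime_pos (q := q)
    rw [← hcast, h] at h1
    simp at h1
  have hnf : ¬ IsField R := by
    intro h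
    have := (IsLocalRing.isField_iff_maximalIdeal_eq.1 h) ▸ (PadicAlgCl.mem_maximalIdeal_iff (q : R)).2
      (by rw [hcast]; exact PadicAlgCl.norm_prime_lt_one)
    exact hq0 (by simpa using this)
  have : IsDiscreteValuationRing R :=
    List.TFAE.out (IsDiscreteValuationRing.TFAE R hnf) 2 0 |>.1 this
  obtain ⟨ϖ, hϖ⟩ := IsDiscreteValuationRing.exists_irreducible R
  obtain ⟨e, u, hu⟩ := IsDiscreteValuationRing.eq_unit_mul_pow_irreducible hq0 hϖ
  have hnorm (x : R) (k : ℕ) (v : Rˣ) (h : x = v * ϖ ^ k) :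
      ‖((x : L) : PadicAlgCl q)‖ = ‖((ϖ : L) : PadicAlgCl q)‖ ^ k := by
    rw [h]
    have h1 : (((v * ϖ ^ k : R) : L) : PadicAlgCl q) =
      (((v : R) : L) : PadicAlgCl q) * ((ϖ : L) : PadicAlgCl q) ^ k := rfl
    rw [h1, norm_mul, norm_pow, (PadicAlgCl.isUnit_iff_norm_eq_one (v : R)).1 v.isUnit, one_mul]
  have hϖ1 : ‖((ϖ : L) : PadicAlgCl q)‖ < 1 :=
    (PadicAlgCl.mem_maximalIdeal_iff ϖ).1 ((IsLocalRing.mem_maximalIdeal _).2 hϖ.not_isUnit)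
  have hqe := hnorm _ e u hu
  rw [hcast] at hqe
  have hϖ0 : 0 < ‖((ϖ : L) : PadicAlgCl q)‖ := by
    refine norm_pos_iff.2 fun h ↦ hϖ.ne_zero ?_
    exact_mod_cast h
  have he : e = P.ramificationIdx ℤ_[q] := by
    have hunder := under_isMaximal_eq_maximalIdeal (A := ℤ_[q]) P
    have hmap : Ideal.map (algebraMap ℤ_[q] R) (P.under ℤ_[q]) = Ideal.span {(q : R)} := by
      rw [hunder, PadicInt.maximalIdeal_eq_span_p, Ideal.map_span, Set.image_singleton, map_natCast]
    exact (ramificationIdx_eq_of_map_under_eq_span P hϖ hu hmap).symm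
  refine ⟨e, he ▸ hL P inferInstance, ?_⟩
  have key (x : R) (hx : x ≠ 0) :
      ∃ k : ℤ, ‖((x : L) : PadicAlgCl q)‖ ^ e = ‖(q : PadicAlgCl q)‖ ^ k := by
    obtain ⟨k, v, hv⟩ := IsDiscreteValuationRing.eq_unit_mul_pow_irreducible hx hϖ
    refine ⟨k, ?_⟩
    rw [hnorm x k v hv, hqe, zpow_natCast, ← pow_mul, ← pow_mul, mul_comm]
  intro x hx hx0
  rcases le_total ‖x‖ 1 with h | h
  · refine key ⟨⟨x, hx⟩, (PadicAlgCl.isIntegral_coe_iff_norm_le_one _).2 h⟩ fun h0 ↦ hx0 ?_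
    exact congrArg (fun z : R ↦ ((z : L) : PadicAlgCl q)) h0
  · obtain ⟨k, hk⟩ := key ⟨⟨x⁻¹, L.inv_mem hx⟩, (PadicAlgCl.isIntegral_coe_iff_norm_le_one _).2 (by
      change ‖x⁻¹‖ ≤ 1
      rw [norm_inv]; exact inv_le_one_of_one_le₀ h)⟩ fun h0 ↦ inv_ne_zero hx0
        (congrArg (fun z : R ↦ ((z : L) : PadicAlgCl q)) h0)
    refine ⟨-k, ?_⟩
    change ‖x⁻¹‖ ^ e = _ at hk
    rw [zpow_neg, ← hk, norm_inv, inv_pow, inv_inv]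

/-- Nonzero elements of a tame extension are, up to smaller elements, radicals of powers of `q` of
degree prime to `q`. -/
theorem TameGalois.IsTame.exists_pow_eq_zpow_and_norm_sub_lt
    {L : IntermediateField ℚ_[q] (PadicAlgCl q)} [FiniteDimensional ℚ_[q] L] (hL : IsTame q L)
    {x : PadicAlgCl q} (hx : x ∈ L) (hx0 : x ≠ 0) :
    ∃ n : ℕ, n.Coprime q ∧ ∃ k : ℤ, ∃ y ∈ L, y ^ n = (q : PadicAlgCl q) ^ k ∧ ‖x - y‖ < ‖x‖ := by
  obtain ⟨e, he, hval⟩ := hL.exists_norm_pow_eq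
  obtain ⟨k, hk⟩ := hval x hx hx0
  have hqpos := PadicAlgCl.norm_prime_pos (q := q)
  have hq0 : (q : PadicAlgCl q) ≠ 0 := norm_pos_iff.1 hqpos
  have hqL : (q : PadicAlgCl q) ∈ L := natCast_mem L q
  -- With `u = x ^ e / q ^ k` a unit, `u ^ N` is close to `1` and has an `e * N`-th root `v` in `L`;
  -- then `y = x / v` satisfies `y ^ (e * N) = q ^ (k * N)`.
  obtain ⟨N, hN, hNu⟩ := PadicAlgCl.exists_norm_pow_sub_one_lt (u := x ^ e / (q : PadicAlgCl q) ^ k)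
    (by rw [norm_div, norm_pow, norm_zpow, hk, div_self (zpow_ne_zero _ hqpos.ne')])
  obtain ⟨v, hvL, hv, hv1⟩ := PadicAlgCl.exists_pow_eq_of_norm_sub_one_lt L
    (pow_mem (L.div_mem (pow_mem hx e) (zpow_mem hqL k)) N) hNu (Nat.Coprime.mul_left he hN)
  have hvn : ‖v‖ = 1 := norm_eq_one_of_norm_sub_one_lt hv1
  have hv0 : v ≠ 0 := norm_ne_zero_iff.1 (by rw [hvn]; exact one_ne_zero)
  refine ⟨e * N, Nat.Coprime.mul_left he hN, k * N, x / v, L.div_mem hx hvL, ?_, ?_⟩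
  · rw [div_pow, hv, div_pow, ← pow_mul, div_div_cancel₀ (pow_ne_zero _ hx0), zpow_mul, zpow_natCast]
  · have : x - x / v = x / v * (v - 1) := by field_simp
    rw [this, norm_mul, norm_div, hvn, div_one]
    exact mul_lt_of_lt_one_right (norm_pos_iff.2 hx0) hv1

/-- Automorphisms of the maximal tame extension are determined by their values on the radicals of
powers of `q` of degree prime to `q`. -/
theorem TameGalois.tameGaloisGroup_ext {s t : tameGaloisGroup q}
    (h : ∀ (y : maxTame q) (n : ℕ) (k : ℤ), n.Coprime q → y ^ n = (q : maxTame q) ^ k → s y = t y) :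
    s = t := by
  have htame (L : IntermediateField ℚ_[q] (PadicAlgCl q)) [FiniteDimensional ℚ_[q] L]
      (hL : IsTame q L) (hLM : L ≤ maxTame q) (x : PadicAlgCl q) (hx : x ∈ L) :
      s ⟨x, hLM hx⟩ = t ⟨x, hLM hx⟩ := by
    obtain ⟨e, he, hval⟩ := hL.exists_norm_pow_eq
    have hq0 := PadicAlgCl.norm_prime_pos (q := q)
    have hq1 := PadicAlgCl.norm_prime_lt_one (q := q)
    have he0 : e ≠ 0 := by
      rintro rfl
      exact (Fact.out : q.Prime).ne_one (by simpa using he)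
    -- Since `e`-th powers of nonzero norms are integral powers of `‖q‖`, replacing `x` by the
    -- strictly smaller `x - y` gains a full factor `‖q‖`.
    have key (m : ℕ) : ∀ (x : PadicAlgCl q) (hx : x ∈ L),
        ‖((s ⟨x, hLM hx⟩ - t ⟨x, hLM hx⟩ : maxTame q) : PadicAlgCl q)‖ ^ e ≤
          ‖(q : PadicAlgCl q)‖ ^ m * ‖x‖ ^ e := by
      induction m with
      | zero =>
        intro x hx
        rw [pow_zero, one_mul]
        refine pow_le_pow_left₀ (norm_nonneg _) ?_ e
        rw [sub_eq_add_neg]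
        refine (IsUltrametricDist.norm_add_le_max _ _).trans (max_le ?_ ?_)
        · exact (norm_apply_eq s _).le
        · rw [← map_neg]
          refine (norm_apply_eq t _).trans_le ?_
          exact (norm_neg x).le
      | succ m ih =>
        intro x hx
        rcases eq_or_ne x 0 with rfl | hx0
        · have h0 : (⟨0, hLM hx⟩ : maxTame q) = 0 := rfl
          rw [h0, map_zero, map_zero, sub_zero]
          simp [he0]
        obtain ⟨n, hn, k, y, hy, hyn, hlt⟩ := hL.exists_pow_eq_zpow_and_norm_sub_lt hx hx0
        have hy' := h ⟨y, hLM hy⟩ n k hn (Subtype.ext (by push_cast; exact hyn))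
        have hxy : (⟨x, hLM hx⟩ : maxTame q) =
            ⟨y, hLM hy⟩ + ⟨x - y, hLM (L.sub_mem hx hy)⟩ := Subtype.ext (by simp)
        rw [hxy, map_add, map_add, hy', add_sub_add_left_eq_sub]
        refine (ih (x - y) (L.sub_mem hx hy)).trans ?_
        rw [pow_succ, mul_assoc]
        refine mul_le_mul_of_nonneg_left ?_ (pow_nonneg hq0.le m)
        rcases eq_or_ne (x - y) 0 with h0 | h0
        · rw [h0, norm_zero, zero_pow he0]
          positivity
        obtain ⟨a, ha⟩ := hval x hx hx0
        obtain ⟨b, hb⟩ := hval (x - y) (L.sub_mem hx hy) h0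
        have hlt' := pow_lt_pow_left₀ hlt (norm_nonneg _) he0
        rw [ha, hb] at hlt' ⊢
        rw [zpow_lt_zpow_iff_right_of_lt_one₀ hq0 hq1] at hlt'
        rw [← zpow_one_add₀ hq0.ne', zpow_le_zpow_iff_right_of_lt_one₀ hq0 hq1]
        omega
    have hlim : Filter.Tendsto (fun m : ℕ ↦ ‖(q : PadicAlgCl q)‖ ^ m * ‖x‖ ^ e) Filter.atTop
        (nhds 0) := by
      simpa using (tendsto_pow_atTop_nhds_zero_of_lt_one hq0.le hq1).mul_const (‖x‖ ^ e)
    have hle := ge_of_tendsto' hlim fun m ↦ key m x hx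
    have h0 := (pow_eq_zero_iff he0).1 (le_antisymm hle (by positivity))
    rw [norm_eq_zero, ZeroMemClass.coe_eq_zero, sub_eq_zero] at h0
    exact h0
  -- Agreement passes to the compositum because the fixed field of `t⁻¹ * s` contains every finite
  -- tame `L`.
  have hle : maxTame q ≤
      IntermediateField.lift (IntermediateField.fixedField (Subgroup.zpowers (t⁻¹ * s))) := by
    conv_lhs => rw [maxTame]
    refine iSup_le fun ⟨L, hfin, hL⟩ x hx ↦ ?_
    have hLM : L ≤ maxTame q := le_iSup
      (fun L : {L : IntermediateField ℚ_[q] (PadicAlgCl q) // FiniteDimensional ℚ_[q] L ∧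
        IsTame q L} ↦ (L : IntermediateField ℚ_[q] (PadicAlgCl q))) ⟨L, hfin, hL⟩
    refine (IntermediateField.mem_lift (⟨x, hLM hx⟩ : maxTame q)).2 ?_
    rw [IntermediateField.mem_fixedField_iff]
    have h1 : t⁻¹ * s ∈ MulAction.stabilizer (tameGaloisGroup q) (⟨x, hLM hx⟩ : maxTame q) := by
      rw [MulAction.mem_stabilizer_iff, AlgEquiv.smul_def, AlgEquiv.mul_apply, htame L hL hLM x hx,
        ← AlgEquiv.mul_apply, inv_mul_cancel, AlgEquiv.one_apply]
    intro f hf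
    exact (Subgroup.zpowers_le.2 h1) hf
  ext x
  have hx := (IntermediateField.mem_lift x).1 (hle x.2)
  rw [IntermediateField.mem_fixedField_iff] at hx
  have h1 := hx _ (Subgroup.mem_zpowers _)
  rw [AlgEquiv.mul_apply] at h1
  have h2 := congrArg t h1
  rw [← AlgEquiv.mul_apply, mul_inv_cancel, AlgEquiv.one_apply] at h2
  rw [h2]

end Tame

/-! ### The tame relation between Frobenius and inertia -/

theorem ramificationIdx_comap_algEquiv {A B B' : Type*} [CommRing A] [CommRing B] [CommRing B']
    [Algebra A B] [Algebra A B'] [IsDedekindDomain B] [IsDedekindDomain B'] (g : B ≃ₐ[A] B')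
    (P : Ideal B') [P.IsPrime] (h : (P.under A).map (algebraMap A B') ≠ ⊥) :
    (P.comap g).ramificationIdx A = P.ramificationIdx A := by
  have : (P.comap g).LiesOver (P.under A) := ⟨by
    ext x
    simp [Ideal.mem_comap]⟩
  have hne : (P.under A).map (algebraMap A B) ≠ ⊥ := by
    intro h0
    apply h
    rw [← g.toAlgHom.comp_algebraMap, ← Ideal.map_map, h0, Ideal.map_bot]
  have : (P.comap g).IsPrime := Ideal.comap_isPrime g P
  rw [← Ideal.ramificationIdx'_eq_ramificationIdx' (P.under A) P h,
    ← Ideal.ramificationIdx'_eq_ramificationIdx' (P.under A) (P.comap g) hne,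
    Ideal.ramificationIdx'_comap_eq]

namespace TameGalois

variable {q : ℕ} [Fact q.Prime]

theorem IsTame.of_algEquiv {L L' : IntermediateField ℚ_[q] (PadicAlgCl q)}
    [FiniteDimensional ℚ_[q] L] [FiniteDimensional ℚ_[q] L'] (f : L ≃ₐ[ℚ_[q]] L')
    (hL : IsTame q L) : IsTame q L' := by
  intro P hP
  have := PadicAlgCl.isDedekindDomain_integralClosure L
  have := PadicAlgCl.isDedekindDomain_integralClosure L'
  have g : integralClosure ℤ_[q] L ≃ₐ[ℤ_[q]] integralClosure ℤ_[q] L' :=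
    (f.restrictScalars ℤ_[q]).mapIntegralClosure
  rw [← ramificationIdx_comap_algEquiv g P ?_]
  · exact hL _ (Ideal.comap_isMaximal_of_equiv g)
  rw [under_isMaximal_eq_maximalIdeal, PadicInt.maximalIdeal_eq_span_p, Ideal.map_span,
    Set.image_singleton, map_natCast, Ne, Ideal.span_singleton_eq_bot]
  intro h0
  have h1 := PadicAlgCl.norm_prime_pos (q := q)
  have hcast : (((q : integralClosure ℤ_[q] L') : L') : PadicAlgCl q) = q := rfl
  rw [← hcast, h0] at h1
  simp at h1

/-- Conjugates of finite tame extensions are tame, so every automorphism of the algebraic closure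
permutes the fields in the compositum. -/
instance isGalois_maxTame : IsGalois ℚ_[q] (maxTame q) where
  to_normal := by
    rw [IntermediateField.normal_iff_forall_map_le']
    intro s
    rw [maxTame, IntermediateField.map_iSup]
    refine iSup_le fun ⟨L, hfin, hL⟩ ↦ ?_
    have f := L.equivMap (s : PadicAlgCl q →ₐ[ℚ_[q]] PadicAlgCl q)
    have hfin' : FiniteDimensional ℚ_[q] (L.map (s : PadicAlgCl q →ₐ[ℚ_[q]] PadicAlgCl q)) :=
      f.toLinearEquiv.finiteDimensional
    exact le_iSup (fun L : {L : IntermediateField ℚ_[q] (PadicAlgCl q) //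
      FiniteDimensional ℚ_[q] L ∧ IsTame q L} ↦ (L : IntermediateField ℚ_[q] (PadicAlgCl q)))
      ⟨_, hfin', hL.of_algEquiv f⟩

/-- There is a Frobenius element in the tame Galois group. -/
theorem exists_frobenius : ∃ φ : tameGaloisGroup q, ∀ x : maxTame q, ‖(x : PadicAlgCl q)‖ ≤ 1 →
    ‖((φ x - x ^ q : maxTame q) : PadicAlgCl q)‖ < 1 := by
  let Q := IsLocalRing.maximalIdeal (integralClosure ℤ_[q] (maxTame q))
  have hcard : Nat.card (ℤ_[q] ⧸ IsLocalRing.maximalIdeal ℤ_[q]) = q := by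
    exact (Nat.card_congr (PadicInt.residueField (p := q)).toEquiv).trans (Nat.card_zmod q)
  have : Finite (ℤ_[q] ⧸ IsLocalRing.maximalIdeal ℤ_[q]) :=
    Nat.finite_of_card_ne_zero (hcard.trans_ne (Fact.out : q.Prime).ne_zero)
  have : Q.LiesOver (IsLocalRing.maximalIdeal ℤ_[q]) :=
    ⟨(under_isMaximal_eq_maximalIdeal (A := ℤ_[q]) Q).symm⟩
  obtain ⟨φ, hφ⟩ := exists_forall_sub_pow_mem (K := ℚ_[q]) (IsLocalRing.maximalIdeal ℤ_[q]) Q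
  refine ⟨φ, fun x hx ↦ ?_⟩
  have h := hφ ⟨x, (PadicAlgCl.isIntegral_coe_iff_norm_le_one x).2 hx⟩
    ⟨φ x, (PadicAlgCl.isIntegral_coe_iff_norm_le_one _).2 (by rwa [norm_apply_eq])⟩ rfl
  rw [hcard, PadicAlgCl.mem_maximalIdeal_iff] at h
  exact h

/-- Turns the congruences defining inertia and Frobenius into equalities on roots of unity of order
prime to `q`. -/
theorem eq_of_pow_eq_of_norm_sub_lt {n : ℕ} (hn : n.Coprime q) {a b : maxTame q} (hb : b ^ n = 1)
    (hab : a ^ n = 1) (h : ‖((a - b : maxTame q) : PadicAlgCl q)‖ < 1) : a = b := by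
  have hn1 := PadicAlgCl.norm_natCast_eq_one hn
  have hn0 : n ≠ 0 := by rintro rfl; simp at hn1
  have hb1 : ‖(b : PadicAlgCl q)‖ = 1 := by
    have := congrArg (fun z : maxTame q ↦ ‖(z : PadicAlgCl q)‖) hb
    simp only [IntermediateField.coe_pow, norm_pow, OneMemClass.coe_one, norm_one] at this
    exact (pow_eq_one_iff_of_nonneg (norm_nonneg _) hn0).1 this
  have hb0 : (b : PadicAlgCl q) ≠ 0 := norm_ne_zero_iff.1 (by rw [hb1]; exact one_ne_zero)
  have := eq_one_of_pow_eq_one_of_norm_sub_one_lt hn1 (z := (a : PadicAlgCl q) / b)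
    (by rw [div_pow]; exact_mod_cast by rw [hab, hb]; simp)
    (by rw [div_sub_one hb0, norm_div, hb1, div_one]; exact_mod_cast h)
  rw [div_eq_one_iff_eq hb0] at this
  exact Subtype.ext this

/-- A Frobenius element acts on the tame inertia group by raising to the power `q`. -/
theorem exists_conj_eq_pow : ∃ φ : tameGaloisGroup q, ∀ σ ∈ tameInertia q, φ * σ * φ⁻¹ = σ ^ q := by
  obtain ⟨φ, hφ⟩ := exists_frobenius (q := q)
  refine ⟨φ, fun σ hσ ↦ tameGaloisGroup_ext fun y n k hn hy ↦ ?_⟩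
  have hn0 : n ≠ 0 := by
    rintro rfl
    exact (Fact.out : q.Prime).ne_one (by simpa using hn)
  have hq0 : (q : maxTame q) ≠ 0 := by exact_mod_cast (Fact.out : q.Prime).ne_zero
  have hyn : y ^ n ≠ 0 := hy ▸ zpow_ne_zero k hq0
  have hy0 : y ≠ 0 := fun h ↦ hyn (by rw [h, zero_pow hn0])
  have hpow (s : tameGaloisGroup q) : (s y / y) ^ n = 1 := by
    rw [div_pow, ← map_pow, hy, map_zpow₀, map_natCast, ← hy, div_self hyn]
  have hle {z : maxTame q} (hz : z ^ n = 1) : ‖(z : PadicAlgCl q)‖ ≤ 1 := by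
    have := congrArg (fun z : maxTame q ↦ ‖(z : PadicAlgCl q)‖) hz
    simp only [IntermediateField.coe_pow, norm_pow, OneMemClass.coe_one, norm_one] at this
    exact ((pow_eq_one_iff_of_nonneg (norm_nonneg _) hn0).1 this).le
  have hσroot {z : maxTame q} (hz : z ^ n = 1) : σ z = z :=
    eq_of_pow_eq_of_norm_sub_lt hn hz (by rw [← map_pow, hz, map_one]) (hσ z (hle hz))
  have hφroot {z : maxTame q} (hz : z ^ n = 1) : φ z = z ^ q :=
    eq_of_pow_eq_of_norm_sub_lt hn (by rw [← pow_mul, mul_comm, pow_mul, hz, one_pow])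
      (by rw [← map_pow, hz, map_one]) (hφ z (hle hz))
  have hζ : σ y = σ y / y * y := (div_mul_cancel₀ _ hy0).symm
  have hη : φ⁻¹ y = φ⁻¹ y / y * y := (div_mul_cancel₀ _ hy0).symm
  have hζn := hpow σ
  have hηn := hpow φ⁻¹
  set ζ := σ y / y
  set η := φ⁻¹ y / y
  have hσpow (j : ℕ) : (σ ^ j) y = ζ ^ j * y := by
    induction j with
    | zero => simp
    | succ j ih =>
      rw [pow_succ', AlgEquiv.mul_apply, ih, map_mul, map_pow, hσroot hζn, hζ]
      ring
  rw [hσpow, AlgEquiv.mul_apply, AlgEquiv.mul_apply, hη, map_mul, hσroot hηn, hζ]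
  -- Here `σ (φ⁻¹ y) = ζ * φ⁻¹ y`; applying `φ` gives `ζ ^ q * y`, which is `(σ ^ q) y` because `σ`
  -- fixes `ζ`.
  have : η * (ζ * y) = ζ * φ⁻¹ y := by rw [hη]; ring
  rw [this, map_mul, hφroot hζn, ← AlgEquiv.mul_apply, mul_inv_cancel, AlgEquiv.one_apply]

end TameGalois

/-! ### Orders of roots of unity of bounded degree over `ℚ_p` -/

section BoundedOrder

variable {p : ℕ} [Fact p.Prime]

/-- The square is what covers `l = p`; every other prime is a `p`-adic unit. -/
theorem Padic.norm_sq_lt_norm_prime {l : ℕ} (hl : l.Prime) :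
    ‖(p : ℚ_[p])‖ ^ 2 < ‖(l : ℚ_[p])‖ := by
  have hp : p.Prime := Fact.out
  have h1 : ‖(p : ℚ_[p])‖ < 1 := Padic.norm_p_lt_one
  have h0 : 0 < ‖(p : ℚ_[p])‖ := norm_pos_iff.2 (by exact_mod_cast hp.ne_zero)
  rcases eq_or_ne l p with rfl | hne
  · nlinarith
  · rw [(Padic.norm_natCast_eq_one_iff (p := p) (n := l)).2 ((Nat.coprime_primes hp hl).2 hne.symm)]
    nlinarith

/-- A root of unity of degree at most `d` over `ℚ_p` has order at most `p ^ (2 * d)`. -/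
theorem orderOf_le_of_natDegree_minpoly_le {F : Type*} [Field F] [Algebra ℚ_[p] F] {ζ : F}
    (hζ : IsOfFinOrder ζ) {d : ℕ} (hd : (minpoly ℚ_[p] ζ).natDegree ≤ d) :
    orderOf ζ ≤ p ^ (2 * d) := by
  have hp : p.Prime := Fact.out
  have : CharZero F := charZero_of_injective_algebraMap (algebraMap ℚ_[p] F).injective
  have hp0 : (p : F) ≠ 0 := by exact_mod_cast hp.ne_zero
  let _ : Algebra ℤ_[p] F := ((algebraMap ℚ_[p] F).comp (algebraMap ℤ_[p] ℚ_[p])).toAlgebra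
  have : IsScalarTower ℤ_[p] ℚ_[p] F := IsScalarTower.of_algebraMap_eq' rfl
  obtain ⟨n, hn, hζn⟩ := isOfFinOrder_iff_pow_eq_one.1 hζ
  have hζ0 : ζ ≠ 0 := by
    rintro rfl
    rw [zero_pow hn.ne'] at hζn
    exact zero_ne_one hζn
  have hint : IsIntegral ℤ_[p] ζ := IsIntegral.of_pow hn (hζn ▸ isIntegral_one)
  have hint' : IsIntegral ℤ_[p] ζ⁻¹ := IsIntegral.of_pow hn (by rw [inv_pow, hζn, inv_one]; exact isIntegral_one)
  have hdeg : (minpoly ℤ_[p] ζ).natDegree ≤ d := by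
    rw [minpoly.isIntegrallyClosed_eq_field_fractions' ℚ_[p] hint,
      (minpoly.monic hint).natDegree_map] at hd
    exact hd
  obtain ⟨i, j, hij, hj, g, hg⟩ := exists_pow_sub_pow_eq_sq_mul (minpoly.monic hint)
    (minpoly.aeval ℤ_[p] ζ)
  have h1 : ζ ^ (j - i) = 1 := by
    refine eq_one_of_pow_eq_one_of_eq_one_add_mul (integralClosure ℤ_[p] F).toSubring
      (a := (p : F) ^ 2) (y := Polynomial.aeval ζ g * ζ⁻¹ ^ i) (pow_mem (natCast_mem _ p) 2) ?_ hn
      (by rw [← pow_mul, mul_comm, pow_mul, hζn, one_pow]) ?_ ?_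
    -- Here `s = l / p ^ 2` lies in `ℚ_p`; being integral it would lie in `ℤ_p`, against `‖p‖ ^ 2 <
    -- ‖l‖`.
    · intro l hl s hs hls
      have hs' : s = algebraMap ℚ_[p] F ((l : ℚ_[p]) / (p : ℚ_[p]) ^ 2) := by
        rw [map_div₀, map_pow, map_natCast, map_natCast, hls]
        field_simp
      change IsIntegral ℤ_[p] s at hs
      rw [hs', isIntegral_algebraMap_iff (algebraMap ℚ_[p] F).injective] at hs
      obtain ⟨a, ha⟩ := IsIntegrallyClosed.algebraMap_eq_of_integral hs
      have hle : ‖(l : ℚ_[p]) / (p : ℚ_[p]) ^ 2‖ ≤ 1 := by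
        rw [← ha]
        exact PadicInt.norm_le_one a
      have hpos : 0 < ‖(p : ℚ_[p])‖ := norm_pos_iff.2 (by exact_mod_cast hp.ne_zero)
      rw [norm_div, norm_pow, div_le_one (by positivity)] at hle
      exact hle.not_gt (Padic.norm_sq_lt_norm_prime hl)
    · exact (adjoin_le_integralClosure hint (Polynomial.aeval_mem_adjoin_singleton _ _)).mul
        (hint'.pow i)
    · rw [← mul_assoc, ← hg, sub_mul, ← mul_pow, mul_inv_cancel₀ hζ0, one_pow,
        pow_sub₀ _ hζ0 hij.le, inv_pow]
      ring
  calc orderOf ζ ≤ j - i := Nat.le_of_dvd (Nat.sub_pos_of_lt hij) (orderOf_dvd_of_pow_eq_one h1)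
    _ ≤ j := Nat.sub_le _ _
    _ ≤ _ := hj
    _ ≤ p ^ (2 * d) := Nat.pow_le_pow_right hp.pos (by omega)

/-- Multiplicativity of degrees in `k ⊆ K ⊆ K(x)`, the minimal polynomial over `K` being a divisor
of `f`. -/
theorem natDegree_minpoly_le_finrank_mul {k K F : Type*} [Field k] [Field K] [Field F] [Algebra k K]
    [Algebra K F] [Algebra k F] [IsScalarTower k K F] [FiniteDimensional k K]
    {f : Polynomial K} (hf : f.Monic) {x : F} (hx : Polynomial.aeval x f = 0) :
    (minpoly k x).natDegree ≤ Module.finrank k K * f.natDegree := by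
  have hint : IsIntegral K x := ⟨f, hf, hx⟩
  have := IntermediateField.adjoin.finiteDimensional hint
  have : FiniteDimensional k (IntermediateField.adjoin K {x}) :=
    FiniteDimensional.trans k K _
  have h1 := minpoly.natDegree_le (A := k) (IntermediateField.AdjoinSimple.gen K x)
  have : IsScalarTower k (IntermediateField.adjoin K {x}) F :=
    IsScalarTower.of_algebraMap_eq fun a ↦ by
      rw [IsScalarTower.algebraMap_apply k K F,
        IsScalarTower.algebraMap_apply k K (IntermediateField.adjoin K {x})]
      rfl
  have h2 : minpoly k x = minpoly k (IntermediateField.AdjoinSimple.gen K x) := by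
    rw [← minpoly.algebraMap_eq (algebraMap (IntermediateField.adjoin K {x}) F).injective,
      IntermediateField.AdjoinSimple.algebraMap_gen]
  rw [h2]
  refine h1.trans ?_
  rw [← Module.finrank_mul_finrank k K, IntermediateField.adjoin.finrank hint]
  exact Nat.mul_le_mul_left _
    (Polynomial.natDegree_le_of_dvd (minpoly.dvd K x hx) hf.ne_zero)

end BoundedOrder

/-! ### Eigenvalues of matrices -/

section Eigenvalues

/-- The eigenvalues of a matrix conjugate to its `q`-th power are roots of unity. -/
theorem Matrix.isOfFinOrder_of_conj_eq_pow {K F : Type*} [Field K] [Field F] [Algebra K F] {m : ℕ}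
    {A U : GL (Fin m) K} {q : ℕ} (hq : 1 < q) (h : U * A * U⁻¹ = A ^ q) {ζ : F}
    (hζ : Polynomial.aeval ζ (A : Matrix (Fin m) (Fin m) K).charpoly = 0) : IsOfFinOrder ζ := by
  have hchar : ((A : Matrix (Fin m) (Fin m) K) ^ q).charpoly =
      (A : Matrix (Fin m) (Fin m) K).charpoly := by
    rw [← Units.val_pow_eq_pow_val, ← h, Units.val_mul, Units.val_mul, Matrix.coe_units_inv,
      Matrix.charpoly_units_conj]
  have hroot (M : Matrix (Fin m) (Fin m) K) (z : F) : Polynomial.aeval z M.charpoly = 0 ↔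
      z ∈ spectrum F ((algebraMap K F).mapMatrix M) := by
    rw [Matrix.mem_spectrum_iff_isRoot_charpoly, RingHom.mapMatrix_apply, Matrix.charpoly_map,
      Polynomial.IsRoot, Polynomial.eval_map_algebraMap]
  have hstep (z : F) (hz : Polynomial.aeval z (A : Matrix (Fin m) (Fin m) K).charpoly = 0) :
      Polynomial.aeval (z ^ q) (A : Matrix (Fin m) (Fin m) K).charpoly = 0 := by
    rw [← hchar, hroot, map_pow]
    exact spectrum.pow_mem_pow _ q ((hroot _ _).1 hz)
  have hiter (i : ℕ) :
      Polynomial.aeval (ζ ^ q ^ i) (A : Matrix (Fin m) (Fin m) K).charpoly = 0 := by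
    induction i with
    | zero => simpa using hζ
    | succ i ih => rw [pow_succ, pow_mul]; exact hstep _ ih
  have hζ0 : ζ ≠ 0 := by
    rintro rfl
    exact spectrum.zero_notMem_iff F |>.2 (A.isUnit.map (algebraMap K F).mapMatrix)
      ((hroot _ _).1 hζ)
  -- All `ζ ^ q ^ i` are roots of one polynomial, so two coincide and `ζ` is killed by a difference
  -- of powers of `q`.
  have hfin : (Set.range fun i : ℕ ↦ ζ ^ q ^ i).Finite := by
    refine Set.Finite.subset (Polynomial.rootSet_finite
      (A : Matrix (Fin m) (Fin m) K).charpoly F) ?_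
    rintro _ ⟨i, rfl⟩
    exact (Polynomial.mem_rootSet.2 ⟨(Matrix.charpoly_monic _).ne_zero, hiter i⟩)
  obtain ⟨i, j, hij, hne⟩ : ∃ i j : ℕ, ζ ^ q ^ i = ζ ^ q ^ j ∧ i ≠ j := by
    by_contra! hcon
    exact Set.infinite_range_of_injective (fun i j hij ↦ hcon i j hij) hfin
  wlog hlt : i < j generalizing i j
  · exact this j i hij.symm hne.symm (lt_of_le_of_ne (not_lt.1 hlt) hne.symm)
  have hpow := Nat.pow_lt_pow_right hq hlt
  refine isOfFinOrder_iff_pow_eq_one.2 ⟨q ^ j - q ^ i, Nat.sub_pos_of_lt hpow, ?_⟩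
  rw [pow_sub₀ _ hζ0 hpow.le, ← hij, mul_inv_cancel₀ (pow_ne_zero _ hζ0)]

theorem Matrix.exists_aeval_charpoly_eq_zero_ne_one {K F : Type*} [Field K] [Field F] [IsAlgClosed F]
    [Algebra K F] {m : ℕ} {A : Matrix (Fin m) (Fin m) K}
    (h : A.charpoly ≠ (Polynomial.X - 1) ^ m) :
    ∃ ζ : F, Polynomial.aeval ζ A.charpoly = 0 ∧ ζ ≠ 1 := by
  by_contra! hcon
  apply h
  apply Polynomial.map_injective (algebraMap K F) (algebraMap K F).injective
  have hm : (A.charpoly.map (algebraMap K F)).Monic := (Matrix.charpoly_monic A).map _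
  have hs := IsAlgClosed.splits (A.charpoly.map (algebraMap K F))
  have hroots : (A.charpoly.map (algebraMap K F)).roots = Multiset.replicate m 1 := by
    rw [Multiset.eq_replicate]
    constructor
    · rw [← hs.natDegree_eq_card_roots, (Matrix.charpoly_monic A).natDegree_map,
        Matrix.charpoly_natDegree_eq_dim, Fintype.card_fin]
    · intro b hb
      refine hcon b ?_
      rw [Polynomial.mem_roots hm.ne_zero, Polynomial.IsRoot, Polynomial.eval_map_algebraMap] at hb
      exact hb
  rw [hs.eq_prod_roots_of_monic hm, hroots]
  simp

/-- Comes from `z - (1 + a M) = a ((z - 1) / a - M)`; it makes `(z - 1) / a` an eigenvalue of `M`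
when `z` is one of `1 + a M`. -/
theorem Matrix.eval_charpoly_one_add_smul {F : Type*} [Field F] {m : ℕ}
    (M : Matrix (Fin m) (Fin m) F) {a : F} (ha : a ≠ 0) (z : F) :
    (1 + a • M).charpoly.eval z = a ^ m * M.charpoly.eval ((z - 1) / a) := by
  rw [Matrix.eval_charpoly, Matrix.eval_charpoly]
  have : Matrix.scalar (Fin m) z - (1 + a • M) = a • (Matrix.scalar (Fin m) ((z - 1) / a) - M) := by
    ext i j
    by_cases hij : i = j
    · subst hij
      simp [Matrix.scalar_apply]
      field_simp
      ring
    · simp [Matrix.scalar_apply, hij]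
  rw [this, Matrix.det_smul, Fintype.card_fin]

end Eigenvalues

/-! ### Congruences modulo powers of `𝔪` -/

namespace TameGalois

variable (p : ℕ) [Fact p.Prime] (K : Type*) [NormedField K] [NormedAlgebra ℚ_[p] K]

theorem mem_maximalIdeal_ringOfIntegers_iff (x : ringOfIntegers p K) :
    x ∈ IsLocalRing.maximalIdeal (ringOfIntegers p K) ↔ ‖(x : K)‖ < 1 := by
  rw [IsLocalRing.mem_maximalIdeal, mem_nonunits_iff, ← not_iff_not, not_not, not_lt]
  constructor
  · intro h
    obtain ⟨y, hy⟩ := h.exists_right_inv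
    have h1 := congrArg (fun z : ringOfIntegers p K ↦ ‖(z : K)‖) hy
    change ‖(x : K) * y‖ = ‖(1 : K)‖ at h1
    rw [norm_mul, norm_one] at h1
    rw [← h1]
    exact mul_le_of_le_one_right (norm_nonneg _) ((mem_ringOfIntegers_iff p K _).1 y.2)
  · intro h
    have hx : (x : K) ≠ 0 := norm_pos_iff.1 (one_pos.trans_le h)
    exact IsUnit.of_mul_eq_one ⟨(x : K)⁻¹, (mem_ringOfIntegers_iff p K _).2
      (by rw [norm_inv]; exact inv_le_one_of_one_le₀ h)⟩ (Subtype.ext (mul_inv_cancel₀ hx))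

/-- `K` is locally compact and the open unit ball is closed, so the norm attains its maximum there
at some `π`; then `𝔪 ⊆ (π)` and `𝔪 ^ N ⊆ (π ^ N)`. -/
theorem exists_maximalIdeal_pow_le [FiniteDimensional ℚ_[p] K] {c : ℝ} (hc : 0 < c) :
    ∃ N : ℕ, ∀ x ∈ IsLocalRing.maximalIdeal (ringOfIntegers p K) ^ N, ‖(x : K)‖ ≤ c := by
  have : IsUltrametricDist K := IsUltrametricDist.of_normedAlgebra ℚ_[p]
  have : ProperSpace K := FiniteDimensional.proper ℚ_[p] K
  have hcomp : IsCompact (Metric.ball (0 : K) 1) :=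
    Metric.isCompact_of_isClosed_isBounded (IsUltrametricDist.isClosed_ball 0 1) Metric.isBounded_ball
  obtain ⟨π, hπ, hmax⟩ := hcomp.exists_isMaxOn ⟨0, by simp⟩ continuous_norm.continuousOn
  have hπ1 : ‖π‖ < 1 := by simpa using hπ
  have hmax' (x : K) (hx : ‖x‖ < 1) : ‖x‖ ≤ ‖π‖ := hmax (by simpa using hx)
  have hp1 : ‖(p : K)‖ = ‖(p : ℚ_[p])‖ := by
    rw [← map_natCast (algebraMap ℚ_[p] K), norm_algebraMap']
  have hπ0 : 0 < ‖π‖ := by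
    refine lt_of_lt_of_le ?_ (hmax' p (hp1 ▸ Padic.norm_p_lt_one))
    rw [hp1, norm_pos_iff]
    exact_mod_cast (Fact.out : p.Prime).ne_zero
  let ϖ : ringOfIntegers p K := ⟨π, (mem_ringOfIntegers_iff p K π).2 hπ1.le⟩
  have hle : IsLocalRing.maximalIdeal (ringOfIntegers p K) ≤ Ideal.span {ϖ} := by
    intro x hx
    rw [mem_maximalIdeal_ringOfIntegers_iff] at hx
    rw [Ideal.mem_span_singleton]
    refine ⟨⟨x / π, (mem_ringOfIntegers_iff p K _).2 ?_⟩, Subtype.ext ?_⟩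
    · rw [norm_div]
      exact div_le_one_of_le₀ (hmax' x hx) (norm_nonneg _)
    · exact (mul_div_cancel₀ _ (norm_pos_iff.1 hπ0)).symm
  obtain ⟨N, hN⟩ := exists_pow_lt_of_lt_one hc hπ1
  refine ⟨N, fun x hx ↦ ?_⟩
  have hx' := Ideal.pow_right_mono hle N hx
  rw [Ideal.span_singleton_pow, Ideal.mem_span_singleton] at hx'
  obtain ⟨y, rfl⟩ := hx'
  change ‖π ^ N * y‖ ≤ c
  rw [norm_mul, norm_pow]
  exact (mul_le_of_le_one_right (by positivity) ((mem_ringOfIntegers_iff p K _).1 y.2)).trans hN.le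

variable {p K}

/-- If a matrix with integral entries is congruent to `1` modulo `p ^ 2`, then its only eigenvalue
that is a root of unity is `1`. -/
theorem eq_one_of_aeval_charpoly_one_add_smul_eq_zero {m : ℕ}
    (M : Matrix (Fin m) (Fin m) (ringOfIntegers p K)) {F : Type*} [Field F] [Algebra K F] {ζ : F}
    (hζ : IsOfFinOrder ζ) (h : Polynomial.aeval ζ
      (1 + (p : K) ^ 2 • M.map (algebraMap (ringOfIntegers p K) K)).charpoly = 0) : ζ = 1 := by
  have hp : p.Prime := Fact.out
  have : CharZero K := charZero_of_injective_algebraMap (algebraMap ℚ_[p] K).injective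
  have : CharZero F := charZero_of_injective_algebraMap (algebraMap K F).injective
  have hp0 : (p : F) ≠ 0 := by exact_mod_cast hp.ne_zero
  have hpK : (p : K) ≠ 0 := by exact_mod_cast hp.ne_zero
  let _ : Algebra (ringOfIntegers p K) F :=
    ((algebraMap K F).comp (algebraMap (ringOfIntegers p K) K)).toAlgebra
  have : IsScalarTower (ringOfIntegers p K) K F := IsScalarTower.of_algebraMap_eq' rfl
  obtain ⟨n, hn, hζn⟩ := isOfFinOrder_iff_pow_eq_one.1 hζ
  refine eq_one_of_pow_eq_one_of_eq_one_add_mul (integralClosure (ringOfIntegers p K) F).toSubring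
      (a := (p : F) ^ 2) (y := (ζ - 1) / (p : F) ^ 2) (pow_mem (natCast_mem _ p) 2) ?_ hn hζn ?_ ?_
  · intro l hl s hs hls
    have hs' : s = algebraMap K F ((l : K) / (p : K) ^ 2) := by
      rw [map_div₀, map_pow, map_natCast, map_natCast, hls]
      field_simp
    change IsIntegral (ringOfIntegers p K) s at hs
    rw [hs', isIntegral_algebraMap_iff (algebraMap K F).injective] at hs
    obtain ⟨a, ha⟩ := IsIntegrallyClosed.algebraMap_eq_of_integral hs
    have hle : ‖(l : K) / (p : K) ^ 2‖ ≤ 1 := by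
      rw [← ha]
      exact (mem_ringOfIntegers_iff p K _).1 a.2
    have hcast (r : ℕ) : ‖(r : K)‖ = ‖(r : ℚ_[p])‖ := by
      rw [← map_natCast (algebraMap ℚ_[p] K), norm_algebraMap']
    rw [norm_div, norm_pow, div_le_one (by positivity), hcast, hcast] at hle
    exact hle.not_gt (Padic.norm_sq_lt_norm_prime hl)
  -- `(ζ - 1) / p ^ 2` is an eigenvalue of the integral matrix `M`, hence integral over `𝒪`.
  · refine ⟨M.charpoly, Matrix.charpoly_monic M, ?_⟩
    have hmap : (1 + (p : K) ^ 2 • M.map (algebraMap (ringOfIntegers p K) K)).map (algebraMap K F) =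
        1 + (p : F) ^ 2 • M.map (algebraMap (ringOfIntegers p K) F) := by
      ext i j
      by_cases hij : i = j
      · subst hij
        simp [IsScalarTower.algebraMap_apply (ringOfIntegers p K) K F]
      · simp [hij, IsScalarTower.algebraMap_apply (ringOfIntegers p K) K F]
    rw [← Polynomial.eval_map_algebraMap, ← Matrix.charpoly_map, hmap,
      Matrix.eval_charpoly_one_add_smul _ (pow_ne_zero 2 hp0), Matrix.charpoly_map,
      Polynomial.eval_map] at h
    exact (mul_eq_zero.1 h).resolve_left (pow_ne_zero _ (pow_ne_zero 2 hp0))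
  · field_simp
    ring

end TameGalois

/-! ### Application to representations of `G_q` -/

namespace TameGalois

theorem isOfFinOrder_of_aeval_charpoly_eq_zero {q : ℕ} [Fact q.Prime] {τ : tameGaloisGroup q}
    (hτ : τ ∈ tameInertia q) {K F : Type*} [Field K] [Field F] [Algebra K F] {m : ℕ}
    (θ : tameGaloisGroup q →* GL (Fin m) K) {ζ : F}
    (hζ : Polynomial.aeval ζ (θ τ : Matrix (Fin m) (Fin m) K).charpoly = 0) : IsOfFinOrder ζ := by
  obtain ⟨φ, hφ⟩ := exists_conj_eq_pow (q := q)
  refine Matrix.isOfFinOrder_of_conj_eq_pow (U := θ φ) (Fact.out : q.Prime).one_lt ?_ hζ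
  rw [← map_inv, ← map_mul, ← map_mul, hφ τ hτ, map_pow]

theorem IsTameInertiaGenerator.mem {q : ℕ} [Fact q.Prime] {τ : tameGaloisGroup q}
    (hτ : IsTameInertiaGenerator τ) : τ ∈ tameInertia q :=
  hτ ▸ Subgroup.le_topologicalClosure _ (Subgroup.mem_zpowers τ)

/-- An element of the kernel of the reduction of an integral conjugate of `θ` has the same
characteristic polynomial under `θ` as an integral matrix congruent to `1` modulo `p ^ 2`. -/
theorem exists_charpoly_eq_of_reduction_eq_one {p : ℕ} [Fact p.Prime] {K : Type*} [NormedField K]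
    [NormedAlgebra ℚ_[p] K] {m N : ℕ}
    (hN : ∀ x ∈ IsLocalRing.maximalIdeal (ringOfIntegers p K) ^ N, ‖(x : K)‖ ≤ ‖(p : K) ^ 2‖)
    {G : Type*} [Group G] {θ : G →* GL (Fin m) K} {ρ : G →* GL (Fin m) (ringOfIntegers p K)}
    (h : IsIntegralConjugate θ ρ) {s : G} (hs : reduction ρ N s = 1) :
    ∃ M : Matrix (Fin m) (Fin m) (ringOfIntegers p K),
      (θ s : Matrix (Fin m) (Fin m) K).charpoly =
        (1 + (p : K) ^ 2 • M.map (algebraMap (ringOfIntegers p K) K)).charpoly := by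
  have : CharZero K := charZero_of_injective_algebraMap (algebraMap ℚ_[p] K).injective
  have hpK : (p : K) ^ 2 ≠ 0 := pow_ne_zero 2 (by exact_mod_cast (Fact.out : p.Prime).ne_zero)
  obtain ⟨g, hg⟩ := h
  let D : Matrix (Fin m) (Fin m) (ringOfIntegers p K) := (ρ s).val - 1
  have hD (i j : Fin m) : D i j ∈ IsLocalRing.maximalIdeal (ringOfIntegers p K) ^ N := by
    have h1 := congrArg (fun U ↦ U.val i j) hs
    change Ideal.Quotient.mk _ ((ρ s).val i j) =
      (1 : Matrix (Fin m) (Fin m) (ringOfIntegers p K ⧸ _)) i j at h1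
    have h2 : D i j = (ρ s).val i j - (1 : Matrix (Fin m) (Fin m) (ringOfIntegers p K)) i j := rfl
    rw [← Ideal.Quotient.eq_zero_iff_mem, h2, map_sub, h1, sub_eq_zero]
    by_cases hij : i = j
    · subst hij; simp
    · simp [hij]
  have hint (i j : Fin m) : (D i j : K) / (p : K) ^ 2 ∈ ringOfIntegers p K := by
    rw [mem_ringOfIntegers_iff, norm_div]
    exact div_le_one_of_le₀ (hN _ (hD i j)) (norm_nonneg _)
  let M : Matrix (Fin m) (Fin m) (ringOfIntegers p K) := fun i j ↦ ⟨_, hint i j⟩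
  refine ⟨M, ?_⟩
  have h1 := congrArg Units.val (hg s)
  have h2 : (Matrix.GeneralLinearGroup.map (algebraMap (ringOfIntegers p K) K) (ρ s)).val =
      1 + (p : K) ^ 2 • M.map (algebraMap (ringOfIntegers p K) K) := by
    ext i j
    have h3 : (ρ s).val i j = (1 : Matrix (Fin m) (Fin m) (ringOfIntegers p K)) i j + D i j := by
      simp [D]
    change algebraMap (ringOfIntegers p K) K ((ρ s).val i j) =
      (1 : Matrix (Fin m) (Fin m) K) i j + (p : K) ^ 2 * ((D i j : K) / (p : K) ^ 2)
    rw [h3, map_add, mul_div_cancel₀ _ hpK]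
    congr 1
    by_cases hij : i = j
    · subst hij; simp
    · simp [hij]
  rw [← h2, h1, Units.val_mul, Units.val_mul, Matrix.coe_units_inv, Matrix.charpoly_units_conj]

end TameGalois

theorem corollary1 (p : ℕ) [Fact p.Prime] (K : Type*) [NormedField K] [NormedAlgebra ℚ_[p] K]
    [FiniteDimensional ℚ_[p] K] (m : ℕ) :
    -- the eigenvalues of `θ(τ_q)` are roots of unity of bounded order
    (∃ B : ℕ, ∀ (q : ℕ) [Fact q.Prime] (τ : TameGalois.tameGaloisGroup q),
      TameGalois.IsTameInertiaGenerator τ →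
      ∀ θ : TameGalois.tameGaloisGroup q →* GL (Fin m) K, Continuous θ →
      ∀ ζ : AlgebraicClosure K,
        Polynomial.aeval ζ (θ τ : Matrix (Fin m) (Fin m) K).charpoly = 0 →
        IsOfFinOrder ζ ∧ orderOf ζ ≤ B) ∧
    -- non-unipotent ramification is visible modulo a fixed power of the maximal ideal
    (∃ N : ℕ, ∀ (q : ℕ) [Fact q.Prime] (τ : TameGalois.tameGaloisGroup q),
      TameGalois.IsTameInertiaGenerator τ →
      ∀ θ : TameGalois.tameGaloisGroup q →* GL (Fin m) K, Continuous θ →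
      (θ τ : Matrix (Fin m) (Fin m) K).charpoly ≠ (Polynomial.X - 1) ^ m →
      ∀ ρ : TameGalois.tameGaloisGroup q →* GL (Fin m) (TameGalois.ringOfIntegers p K),
        TameGalois.IsIntegralConjugate θ ρ →
        TameGalois.IsRamified (TameGalois.reduction ρ N)) := by
  refine ⟨⟨p ^ (2 * (Module.finrank ℚ_[p] K * m)), ?_⟩, ?_⟩
  · intro q _ τ hτ θ _ ζ hζ
    have hfin := TameGalois.isOfFinOrder_of_aeval_charpoly_eq_zero hτ.mem θ hζ
    refine ⟨hfin, orderOf_le_of_natDegree_minpoly_le hfin ?_⟩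
    have h := natDegree_minpoly_le_finrank_mul (k := ℚ_[p]) (Matrix.charpoly_monic _) hζ
    rwa [Matrix.charpoly_natDegree_eq_dim, Fintype.card_fin] at h
  · have : CharZero K := charZero_of_injective_algebraMap (algebraMap ℚ_[p] K).injective
    -- `N` is chosen with `𝔪 ^ N ⊆ p ^ 2 𝒪`, before `q` and `θ` enter; `τ` itself then witnesses
    -- ramification.
    obtain ⟨N, hN⟩ := TameGalois.exists_maximalIdeal_pow_le p K (c := ‖(p : K) ^ 2‖)
      (norm_pos_iff.2 (pow_ne_zero 2 (by exact_mod_cast (Fact.out : p.Prime).ne_zero)))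
    refine ⟨N, fun q _ τ hτ θ _ hθ ρ hρ ↦ ⟨τ, hτ.mem, fun hred ↦ ?_⟩⟩
    obtain ⟨ζ, hζ, hne⟩ :=
      Matrix.exists_aeval_charpoly_eq_zero_ne_one (F := AlgebraicClosure K) hθ
    obtain ⟨M, hM⟩ := TameGalois.exists_charpoly_eq_of_reduction_eq_one hN hρ hred
    have hfin := TameGalois.isOfFinOrder_of_aeval_charpoly_eq_zero hτ.mem θ hζ
    exact hne (TameGalois.eq_one_of_aeval_charpoly_one_add_smul_eq_zero M hfin (hM ▸ hζ))
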